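/- Let $K$ be a number field and $S$ a finite set of primes of $K$ containing all archimedean ones; "prime" below means non-archimedean prime. Let $K_S/K$ be the maximal extension (inside an algebraic closure of $K$) unramified outside $S$, with Galois group $G_{K,S}$. Assume condition (C3): for every finite subextension $L$ of $K_S/K$ and any two primes $\mathfrak p\neq\mathfrak q$ of $L$, the decomposition subgroup of $\mathfrak q$ in $K_S^{\{\mathfrak p\}}/L$ is infinite, where $K_S^{\{\mathfrak p\}}$ is the maximal extension of $L$ unramified outside $S$ and completely split in $\mathfrak p$. Let $U\subseteq G_{K,S}$ be an open subgroup, $L=K_S^U$, and let $H\subseteq U$ be a closed subgroup, normal in $U$ and not open. For a closed subgroup $H'\subseteq H$ that is normal in $U$, a prime $\mathfrak p$ of $L$ is said to lie under $H'$ if for some (equivalently, any) extension $\bar{\mathfrak p}$ of $\mathfrak p$ to $K_S$ the subgroup $D_{\bar{\mathfrak p}/\mathfrak p}\cap H'$ is open in the decomposition group $D_{\bar{\mathfrak p}/\mathfrak p}\subseteq U=\mathrm{Gal}(K_S/L)$. Let $z_S(U;H')$ be the number (possibly $\infty$) of primes of $L$ lying outside $S$ and under $H'$. For a prime $\mathfrak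 p$ of $L$ let $e_{\mathfrak p}$ and $f_{\mathfrak p}$ be the ramification index and inertia degree of $\mathfrak p$ in the Galois extension $K_S^H/L$, let $\mathrm N\mathfrak p$ be its absolute norm, and put $$\beta(K_S^H/L)=\sum_{\mathfrak p}\frac{1}{e_{\mathfrak p}f_{\mathfrak p}}\log\frac{\mathrm N\mathfrak p^{f_{\mathfrak p}}}{\mathrm N\mathfrak p^{f_{\mathfrak p}}-1}\in[0,\infty],$$ the sum being over the primes $\mathfrak p$ of $L$ with $e_{\mathfrak p}f_{\mathfrak p}<\infty$. Then: (i) $z_S(U;H)=0$ if and only if $$\beta(K_S^H/L)=\sum_{\mathfrak p\in S^f(L),\ e_{\mathfrak p}f_{\mathfrak p}<\infty}\frac{1}{e_{\mathfrak p}f_{\mathfrak p}}\log\frac{\mathrm N\mathfrak p^{f_{\mathfrak p}}}{\mathrm N\mathfrak p^{f_{\mathfrak p}}-1},$$ where $S^f(L)$ is the set of primes of $L$ above the non-archimedean primes in $S$. (ii) $z_S(U;H)>1$ if and only if there exist closed subgroups $H_1,H_2\subseteq H$, normal in $U$, such that $z_S(U;H_1)>0$, $z_S(U;H_2)>0$ and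 $z_S(U;H_1\cap H_2)=0$. -/

import Mathlib

open scoped NumberField Pointwise
open IsDedekindDomain

noncomputable section

namespace ArithCurve

/-! A "prime" of a field `F` algebraic over `ℚ` is a non-archimedean one. For a number field `F`
these are the elements of `HeightOneSpectrum (𝓞 F)`. For an infinite algebraic extension `M` of a
number field, `𝓞 M` is the integral closure of `ℤ` in `M`, and the primes of `M` above a prime `p`
of `F` are the elements of `p.asIdeal.primesOver (𝓞 M)`. -/

section Extensions

variable (F : Type*) [Field F] (M : Type*) [Field M] [Algebra F M]

/-- `S(M)`: the primes of `M` lying above a prime in the set `S` of primes of `F`. -/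
def primesAbove (S : Set (HeightOneSpectrum (𝓞 F))) : Set (HeightOneSpectrum (𝓞 M)) :=
  {P | ∃ p ∈ S, P.asIdeal.LiesOver p.asIdeal}

/-- `M/F` (used for finite extensions of number fields) is unramified at all primes of `F`
outside `S`. -/
def UnramifiedOutside (S : Set (HeightOneSpectrum (𝓞 F))) : Prop :=
  ∀ p : HeightOneSpectrum (𝓞 F), p ∉ S →
    ∀ P ∈ p.asIdeal.primesOver (𝓞 M), P.ramificationIdx (𝓞 F) = 1

/-- `M/F` (used for finite extensions of number fields) is completely split at all primes
in `R`. -/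
def CompletelySplitAt (R : Set (HeightOneSpectrum (𝓞 F))) : Prop :=
  ∀ p ∈ R, ∀ P ∈ p.asIdeal.primesOver (𝓞 M),
    P.ramificationIdx (𝓞 F) = 1 ∧ P.inertiaDeg (𝓞 F) = 1

/-- The maximal subextension of `M/F` that is unramified outside `S` (and the archimedean places,
at which there is no condition) and completely split in `R`: the compositum of all finite
subextensions with these two properties. -/
def maxExt (S R : Set (HeightOneSpectrum (𝓞 F))) : IntermediateField F M :=
  ⨆ E : {E : IntermediateField F M //
    FiniteDimensional F E ∧ UnramifiedOutside F E S ∧ CompletelySplitAt F E R}, E.1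

/-- The decomposition subgroup in `Gal(M/F)` of a prime `P` of `M`. -/
def decompositionSubgroup (P : Ideal (𝓞 M)) : Subgroup Gal(M/F) :=
  MulAction.stabilizer Gal(M/F) P

variable {M} in
/-- The ramification index over `F` of a prime `P` of the (possibly infinite) algebraic
extension `M` of `F`: the supremum of the ramification indices in the finite subextensions. -/
def ramIndex (P : Ideal (𝓞 M)) : ℕ∞ :=
  ⨆ E : {E : IntermediateField F M // FiniteDimensional F E},
    ((P.under (𝓞 E.1)).ramificationIdx (𝓞 F) : ℕ∞)

variable {M} in
/-- The inertia degree over `F` of a prime `P` of the (possibly infinite) algebraic extension `M`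
of `F`: the degree of the extension of residue fields. -/
def resDegree (P : Ideal (𝓞 M)) : ℕ∞ :=
  Cardinal.toENat (Module.rank (𝓞 F ⧸ P.under (𝓞 F)) (𝓞 M ⧸ P))

variable {F}

/-- A prolongation to `M` of the prime `p` of `F`. -/
def prolongation (p : HeightOneSpectrum (𝓞 F)) : Ideal (𝓞 M) :=
  (Classical.arbitrary (p.asIdeal.primesOver (𝓞 M))).1

/-- `e_p(M/F)` for a Galois extension `M/F`: the ramification index of a (any) prolongation. -/
def eIndex (p : HeightOneSpectrum (𝓞 F)) : ℕ∞ := ramIndex F (prolongation M p)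

/-- `f_p(M/F)` for a Galois extension `M/F`: the inertia degree of a (any) prolongation. -/
def fDegree (p : HeightOneSpectrum (𝓞 F)) : ℕ∞ := resDegree F (prolongation M p)

/-- The norm of a prime of a number field: the cardinality of its residue field. -/
def primeNorm (p : HeightOneSpectrum (𝓞 F)) : ℕ := Nat.card (𝓞 F ⧸ p.asIdeal)

open Classical in
/-- The contribution `(1 / (e f)) * log (N p ^ f / (N p ^ f - 1))` of `p` to `β(M/F)`, where
`e = e_p(M/F)` and `f = f_p(M/F)`. Only primes for which `e f` is finite contribute. -/
def betaTerm (p : HeightOneSpectrum (𝓞 F)) : ENNReal :=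
  if eIndex M p ≠ ⊤ ∧ fDegree M p ≠ ⊤ then
    ENNReal.ofReal (1 / ((eIndex M p).toNat * (fDegree M p).toNat : ℝ) *
      Real.log ((primeNorm p : ℝ) ^ (fDegree M p).toNat /
        ((primeNorm p : ℝ) ^ (fDegree M p).toNat - 1)))
  else 0

variable (F)

/-- `β(M/F)`, as the sum in `[0, ∞]` of a family of non-negative real numbers. -/
def beta : ENNReal := ∑' p : HeightOneSpectrum (𝓞 F), betaTerm M p

end Extensions

section Global

variable (K : Type*) [Field K]

/-- `K_S`. The set `S` is given by its non-archimedean part; all archimedean places belong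
to it. -/
abbrev KS (S : Set (HeightOneSpectrum (𝓞 K))) : IntermediateField K (AlgebraicClosure K) :=
  maxExt K (AlgebraicClosure K) S ∅

variable {K} (S : Set (HeightOneSpectrum (𝓞 K)))

/-- The group `G_{K,S}`, with its Krull topology. -/
abbrev GKS : Type _ := Gal(KS K S/K)

/-- `K_S^U`, for a subgroup `U` of `G_{K,S}`. -/
abbrev fixedKS (U : Subgroup (GKS S)) : IntermediateField K (KS K S) :=
  IntermediateField.fixedField U

/-- `K_S^H` as an extension of `K_S^U`, for `H ≤ U`. -/
abbrev fixedKSOver {U H : Subgroup (GKS S)} (h : H ≤ U) :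
    IntermediateField (fixedKS S U) (KS K S) :=
  IntermediateField.extendScalars (IntermediateField.fixedField_antitone h)

/-- Condition (C3): for every finite subextension `L` of `K_S/K` and all primes `p ≠ q` of `L`,
the decomposition subgroup of (any prolongation of) `q` in the maximal extension of `L` that is
unramified outside `S` and completely split in `p` is infinite. That extension lies in
`L_S = K_S`. -/
def ConditionC3 : Prop :=
  ∀ L : IntermediateField K (KS K S), FiniteDimensional K L →
    ∀ p q : HeightOneSpectrum (𝓞 L), p ≠ q →
      ∀ Q ∈ q.asIdeal.primesOver (𝓞 (maxExt L (KS K S) (primesAbove K L S) {p})),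
        Infinite (decompositionSubgroup L (maxExt L (KS K S) (primesAbove K L S) {p}) Q)

/-- The prime `p` of `L = K_S^U` lies under `H`: for some extension `P` of `p` to `K_S`, the
subgroup `D ∩ H` is open in `D`, where `D = D_P ∩ U` is the decomposition subgroup of `P` in
`U = Gal(K_S/L)`. -/
def LiesUnder (U H : Subgroup (GKS S)) (p : HeightOneSpectrum (𝓞 (fixedKS S U))) : Prop :=
  ∃ P ∈ p.asIdeal.primesOver (𝓞 (KS K S)),
    IsOpen ((H.subgroupOf (decompositionSubgroup K (KS K S) P ⊓ U) :
      Subgroup ↥(decompositionSubgroup K (KS K S) P ⊓ U)) :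
        Set ↥(decompositionSubgroup K (KS K S) P ⊓ U))

/-- `z_S(U;H)`: the number of primes of `L = K_S^U` lying outside `S` and under `H`. -/
def zCount (U H : Subgroup (GKS S)) : ℕ∞ :=
  {p : HeightOneSpectrum (𝓞 (fixedKS S U)) |
    p ∉ primesAbove K (fixedKS S U) S ∧ LiesUnder S U H p}.encard

end Global

end ArithCurve

end

/-! Write `D` for the decomposition group in Gal(K_S/L) of a prime P of K_S above p. As H is closed
and `D` compact, `D ∩ H` is open in `D` iff it has finite index. As H is normal in U, `D/(D ∩ H)` is
the decomposition group of p in K_S^H/L. So p lies under H iff that group is finite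
(`finite_decompositionSubgroup_under`, `relIndex_decompositionSubgroup_ne_zero`), i.e. iff e_p and
f_p are finite (`finite_decompositionSubgroup_iff`).

(i) A term of β with e_p f_p finite is strictly positive and all others vanish. The sum over the
finite set S^f(L) is finite and can be cancelled, so equality says exactly that no prime outside S
lies under H.

(ii) A prime under both H₁ and H₂ lies under `H₁ ⊓ H₂`, so if the intersection has none outside S,
the primes witnessing H₁ and H₂ differ. Conversely, for p under H, intersect H with the subgroup
fixing the maximal extension completely split in p. That subgroup contains the decomposition groups
above p (`decompositionSubgroup_le_fixingSubgroup_maxExt`), so p survives; by (C3) no other prime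
does (`exists_inf_of_liesUnder`). Doing this for two primes gives subgroups whose intersection has
no prime under it. -/

noncomputable section

namespace ArithCurve

/-! ### Galois action on primes of infinite extensions -/

section GaloisAction

variable {F M : Type*} [Field F] [Field M] [Algebra F M]

theorem coe_smul_integer (σ : Gal(M/F)) (x : 𝓞 M) : ((σ • x : 𝓞 M) : M) = σ (x : M) := rfl

instance smulCommClass_integers : SMulCommClass Gal(M/F) (𝓞 F) (𝓞 M) where
  smul_comm σ a x := by
    ext
    simp only [coe_smul_integer, Algebra.smul_def, map_mul]
    congr 1
    exact σ.commutes (a : F)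

instance isInvariant_integers [IsGalois F M] : Algebra.IsInvariant (𝓞 F) (𝓞 M) Gal(M/F) where
  isInvariant x hx := by
    obtain ⟨y, hy⟩ := (InfiniteGalois.mem_range_algebraMap_iff_fixed (k := F) (x : M)).2
      fun σ ↦ congrArg (fun z : 𝓞 M ↦ (z : M)) (hx σ)
    have hint : IsIntegral ℤ y :=
      (isIntegral_algebraMap_iff (algebraMap F M).injective).1 (hy ▸ x.2)
    exact ⟨⟨y, hint⟩, NumberField.RingOfIntegers.ext hy⟩

theorem isOpen_stabilizer_integer [Algebra.IsAlgebraic F M] (x : 𝓞 M) :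
    IsOpen (MulAction.stabilizer Gal(M/F) x : Set Gal(M/F)) := by
  have : MulAction.stabilizer Gal(M/F) x = MulAction.stabilizer Gal(M/F) (x : M) := by
    ext σ
    exact NumberField.RingOfIntegers.ext_iff
  rw [this]
  exact stabilizer_isOpen_of_isIntegral _

/-- The Galois group acts transitively on the primes above a given one. -/
theorem exists_smul_eq_of_under_eq [IsGalois F M] (P Q : Ideal (𝓞 M)) [P.IsPrime] [Q.IsPrime]
    (h : P.under (𝓞 F) = Q.under (𝓞 F)) : ∃ σ : Gal(M/F), Q = σ • P := by
  -- For the discrete topology on `𝓞 M`, continuity of the action means open stabilizers; this is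
  -- the input for transitivity under a profinite group.
  let : TopologicalSpace (𝓞 M) := ⊥
  have : DiscreteTopology (𝓞 M) := ⟨rfl⟩
  have : ContinuousSMul Gal(M/F) (𝓞 M) :=
    continuousSMul_iff_stabilizer_isOpen.2 isOpen_stabilizer_integer
  exact Algebra.IsInvariant.exists_smul_of_under_eq_of_profinite (A := 𝓞 F) P Q h

/-- Stabilizing `P` is a condition on each `x` separately, and each is the preimage of a subset of a
discrete space under the continuous orbit map of `x`. -/
theorem isClosed_decompositionSubgroup [Algebra.IsAlgebraic F M] (P : Ideal (𝓞 M)) :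
    IsClosed (decompositionSubgroup F M P : Set Gal(M/F)) := by
  let : TopologicalSpace (𝓞 M) := ⊥
  have : DiscreteTopology (𝓞 M) := ⟨rfl⟩
  have : ContinuousSMul Gal(M/F) (𝓞 M) :=
    continuousSMul_iff_stabilizer_isOpen.2 isOpen_stabilizer_integer
  have h : (decompositionSubgroup F M P : Set Gal(M/F)) =
      ⋂ x : 𝓞 M, {σ | σ • x ∈ P ↔ x ∈ P} := by
    ext σ
    simp only [decompositionSubgroup, SetLike.mem_coe, MulAction.mem_stabilizer_iff,
      Set.mem_iInter, Set.mem_ofPred_eq]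
    rw [← eq_inv_smul_iff, eq_comm, SetLike.ext_iff]
    simp only [Ideal.mem_inv_pointwise_smul_iff]
  rw [h]
  refine isClosed_iInter fun x ↦ ?_
  have hc : Continuous fun σ : Gal(M/F) ↦ σ • x := by fun_prop
  exact (isClosed_discrete {y : 𝓞 M | y ∈ P ↔ x ∈ P}).preimage hc

theorem exists_prime_under_eq {A B : Type*} [Field A] [Field B] [Algebra A B]
    [Algebra.IsIntegral (𝓞 A) (𝓞 B)] (P : Ideal (𝓞 A)) [P.IsPrime] :
    ∃ Q : Ideal (𝓞 B), Q.IsPrime ∧ Q.under (𝓞 A) = P := by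
  obtain ⟨Q, -, hQ, h⟩ := Ideal.exists_ideal_over_prime_of_isIntegral P (⊥ : Ideal (𝓞 B)) (by
    intro x hx
    rw [Ideal.mem_comap, Ideal.mem_bot] at hx
    rw [(FaithfulSMul.algebraMap_injective (𝓞 A) (𝓞 B)) (hx.trans (map_zero _).symm)]
    exact P.zero_mem)
  exact ⟨Q, hQ, h⟩

variable {E : Type*} [Field E] [Algebra F E] [Algebra E M] [IsScalarTower F E M]

omit [IsScalarTower F E M] in
theorem smul_under_eq (σ : Gal(M/F)) (τ : Gal(E/F))
    (h : ∀ x, σ (algebraMap E M x) = algebraMap E M (τ x)) (P : Ideal (𝓞 M)) :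
    τ • P.under (𝓞 E) = (σ • P).under (𝓞 E) := by
  have h' : ∀ x, σ⁻¹ (algebraMap E M x) = algebraMap E M (τ⁻¹ x) := fun x ↦ by
    have := h (τ⁻¹ x)
    rw [← AlgEquiv.mul_apply, mul_inv_cancel, AlgEquiv.one_apply] at this
    rw [← this, ← AlgEquiv.mul_apply, inv_mul_cancel, AlgEquiv.one_apply]
  ext x
  rw [Ideal.mem_pointwise_smul_iff_inv_smul_mem, Ideal.mem_under, Ideal.mem_under,
    Ideal.mem_pointwise_smul_iff_inv_smul_mem]
  have : σ⁻¹ • algebraMap (𝓞 E) (𝓞 M) x = algebraMap (𝓞 E) (𝓞 M) (τ⁻¹ • x) :=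
    NumberField.RingOfIntegers.ext (h' x)
  rw [this]

/-- Every element of the decomposition group of a prime of a subextension lifts to an element
of the decomposition group upstairs. -/
theorem exists_lift_mem_decompositionSubgroup [IsGalois F M] (P : Ideal (𝓞 M)) [P.IsPrime]
    (τ : Gal(E/F)) (hτ : τ ∈ decompositionSubgroup F E (P.under (𝓞 E))) :
    ∃ σ ∈ decompositionSubgroup F M P, ∀ x, σ (algebraMap E M x) = algebraMap E M (τ x) := by
  have : IsGalois E M := IsGalois.tower_top_of_isGalois F E M
  have hl := AlgEquiv.liftNormal_commutes τ M
  -- An arbitrary lift of `τ` moves `P` to a prime with the same trace on `E`; some `ρ` in Gal(M/E)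
  -- moves it back without changing the restriction to `E`.
  obtain ⟨ρ, hρ⟩ := exists_smul_eq_of_under_eq (F := E) (τ.liftNormal M • P) P (by
    rw [← smul_under_eq _ τ hl]
    exact hτ)
  refine ⟨ρ.restrictScalars F * τ.liftNormal M, ?_, fun x ↦ ?_⟩
  · rw [decompositionSubgroup, MulAction.mem_stabilizer_iff, mul_smul]
    exact hρ.symm
  · rw [AlgEquiv.mul_apply, hl]
    exact ρ.commutes _

omit [IsScalarTower F E M] in
theorem mem_decompositionSubgroup_under (P : Ideal (𝓞 M)) (σ : Gal(M/F)) (τ : Gal(E/F))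
    (h : ∀ x, σ (algebraMap E M x) = algebraMap E M (τ x))
    (hσ : σ ∈ decompositionSubgroup F M P) :
    τ ∈ decompositionSubgroup F E (P.under (𝓞 E)) := by
  rw [decompositionSubgroup, MulAction.mem_stabilizer_iff] at hσ ⊢
  rw [smul_under_eq σ τ h, hσ]

end GaloisAction

/-! ### Decomposition groups of subextensions as quotients -/

section DecompositionFinite

variable {F N : Type*} [Field F] [Field N] [Algebra F N] [IsGalois F N]

/-- Lifts lying in the same coset of Gal(N/M) agree on `M`, so lifting embeds the decomposition
group of `M` into a finite coset space. Normality of `M` is not needed in this direction. -/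
theorem finite_decompositionSubgroup_under (M : IntermediateField F N) (P : Ideal (𝓞 N))
    [P.IsPrime] (h : M.fixingSubgroup.relIndex (decompositionSubgroup F N P) ≠ 0) :
    Finite (decompositionSubgroup F M (P.under (𝓞 M))) := by
  choose f hf hfe using exists_lift_mem_decompositionSubgroup (F := F) (E := M) P
  have : Finite (decompositionSubgroup F N P ⧸
      M.fixingSubgroup.subgroupOf (decompositionSubgroup F N P)) :=
    have : (M.fixingSubgroup.subgroupOf (decompositionSubgroup F N P)).FiniteIndex := ⟨h⟩
    inferInstance
  refine Finite.of_injective (fun τ : decompositionSubgroup F M (P.under (𝓞 M)) ↦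
    (QuotientGroup.mk ⟨f τ.1 τ.2, hf τ.1 τ.2⟩ : decompositionSubgroup F N P ⧸
      M.fixingSubgroup.subgroupOf (decompositionSubgroup F N P))) fun τ τ' hτ ↦ ?_
  have := QuotientGroup.eq.1 hτ
  rw [Subgroup.mem_subgroupOf, IntermediateField.mem_fixingSubgroup_iff] at this
  ext x
  have h2 : f τ.1 τ.2 (x : N) = (τ.1 x : M) := hfe τ.1 τ.2 x
  have h3 : f τ'.1 τ'.2 (x : N) = (τ'.1 x : M) := hfe τ'.1 τ'.2 x
  have h4 : f τ.1 τ.2 (x : N) = f τ'.1 τ'.2 (x : N) := by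
    conv_lhs => rw [← this x x.2]
    exact AlgEquiv.apply_symm_apply (f τ.1 τ.2) _
  rw [← h2, h4, h3]

omit [IsGalois F N] in
theorem relIndex_decompositionSubgroup_ne_zero (M : IntermediateField F N) [Normal F M]
    (P : Ideal (𝓞 N)) (h : Finite (decompositionSubgroup F M (P.under (𝓞 M)))) :
    M.fixingSubgroup.relIndex (decompositionSubgroup F N P) ≠ 0 := by
  let r := (AlgEquiv.restrictNormalHom (F := F) (K₁ := N) M).comp
    (decompositionSubgroup F N P).subtype
  have hr : ∀ σ, r σ ∈ decompositionSubgroup F M (P.under (𝓞 M)) := fun σ ↦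
    mem_decompositionSubgroup_under P σ.1 (r σ)
      (fun x ↦ (AlgEquiv.restrictNormal_commutes σ.1 M x).symm) σ.2
  have : Finite (r.codRestrict _ hr).range := inferInstance
  have hk : (r.codRestrict _ hr).ker =
      M.fixingSubgroup.subgroupOf (decompositionSubgroup F N P) := by
    rw [MonoidHom.ker_codRestrict, ← IntermediateField.restrictNormalHom_ker]
    rfl
  rw [Subgroup.relIndex, ← hk, Subgroup.index_ker]
  exact Nat.card_pos.ne'

end DecompositionFinite

/-! ### Finite decomposition group versus finite e and f -/

section FiniteLevel

variable {F M : Type*} [Field F] [NumberField F] [Field M] [Algebra F M]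

theorem numberField_of_finiteDimensional (E : Type*) [Field E] [Algebra F E]
    [FiniteDimensional F E] : NumberField E :=
  have : CharZero E := charZero_of_injective_algebraMap (algebraMap F E).injective
  let : Algebra ℚ E := DivisionRing.toRatAlgebra
  have : IsScalarTower ℚ F E := inferInstance
  { to_charZero := inferInstance
    to_finiteDimensional := Module.Finite.trans F E }

theorem card_decompositionSubgroup_eq_mul {E : Type*} [Field E] [Algebra F E]
    [FiniteDimensional F E] [IsGalois F E] (P : Ideal (𝓞 E)) [P.IsPrime]
    (hP : P.under (𝓞 F) ≠ ⊥) :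
    Nat.card (decompositionSubgroup F E P) = P.ramificationIdx (𝓞 F) * P.inertiaDeg (𝓞 F) := by
  have := numberField_of_finiteDimensional (F := F) E
  set p := P.under (𝓞 F)
  have : p.IsMaximal := Ring.DimensionLEOne.maximalOfPrime hP inferInstance
  have : Finite (𝓞 F ⧸ p) := Ring.HasFiniteQuotients.finiteQuotient hP
  have : Finite p.ResidueField :=
    Finite.of_surjective _ p.bijective_algebraMap_quotient_residueField.2
  have := Ideal.card_stabilizer_eq (G := Gal(E/F)) p P
  rwa [Ideal.ramificationIdxIn_eq_ramificationIdx p P Gal(E/F),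
    Ideal.inertiaDegIn_eq_inertiaDeg p P Gal(E/F)] at this

theorem inertiaDeg_eq_finrank {E : Type*} [Field E] [Algebra F E]
    [FiniteDimensional F E] (P : Ideal (𝓞 E)) [P.IsPrime] (p : Ideal (𝓞 F)) [P.LiesOver p]
    (hp : p ≠ ⊥) :
    P.inertiaDeg (𝓞 F) = Module.finrank (𝓞 F ⧸ p) (𝓞 E ⧸ P) := by
  have := numberField_of_finiteDimensional (F := F) E
  have : p.IsPrime := Ideal.isPrime_of_liesOver P p
  have : p.IsMaximal := Ring.DimensionLEOne.maximalOfPrime hp inferInstance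
  have : P.IsMaximal := Ideal.IsMaximal.of_liesOver_isMaximal P p
  exact Ideal.inertiaDeg_eq_of_isMaximal p P

theorem finite_residueField_of_finiteDimensional {E : Type*} [Field E] [Algebra F E]
    [FiniteDimensional F E] (P : Ideal (𝓞 E)) [P.IsPrime] (p : Ideal (𝓞 F)) [P.LiesOver p] :
    Module.Finite (𝓞 F ⧸ p) (𝓞 E ⧸ P) := by
  have := numberField_of_finiteDimensional (F := F) E
  infer_instance

omit [NumberField F] in
theorem exists_finite_galois_ge [IsGalois F M] (s : Set M) [Finite s] :
    ∃ E : IntermediateField F M, FiniteDimensional F E ∧ IsGalois F E ∧ s ⊆ E :=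
  ⟨(FiniteGaloisIntermediateField.adjoin F s).toIntermediateField, inferInstance, inferInstance,
    FiniteGaloisIntermediateField.subset_adjoin F s⟩

omit [NumberField F] in
theorem exists_finite_galois_ge_intermediateField [IsGalois F M] (E : IntermediateField F M)
    [FiniteDimensional F E] :
    ∃ E' : IntermediateField F M, FiniteDimensional F E' ∧ IsGalois F E' ∧ E ≤ E' := by
  obtain ⟨s, hs⟩ := (IntermediateField.essFiniteType_iff (K := E)).1 inferInstance
  obtain ⟨E', h1, h2, h3⟩ := exists_finite_galois_ge (F := F)
    (s : Set M)
  exact ⟨E', h1, h2, hs ▸ IntermediateField.adjoin_le_iff.2 h3⟩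

omit [NumberField F] in
theorem card_decompositionSubgroup_under_le [IsGalois F M] (P : Ideal (𝓞 M)) [P.IsPrime]
    [Finite (decompositionSubgroup F M P)] (E : IntermediateField F M) :
    Nat.card (decompositionSubgroup F E (P.under (𝓞 E))) ≤
      Nat.card (decompositionSubgroup F M P) := by
  choose f hf hfe using exists_lift_mem_decompositionSubgroup (F := F) (E := E) P
  refine Nat.card_le_card_of_injective
    (fun τ : decompositionSubgroup F E (P.under (𝓞 E)) ↦
      (⟨f τ.1 τ.2, hf τ.1 τ.2⟩ : decompositionSubgroup F M P)) fun τ τ' h ↦ ?_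
  ext x
  have h' : f τ.1 τ.2 = f τ'.1 τ'.2 := congrArg Subtype.val h
  exact (hfe τ.1 τ.2 x).symm.trans (h' ▸ hfe τ'.1 τ'.2 x)

theorem ramificationIdx_le_of_le {E E' : IntermediateField F M} [FiniteDimensional F E']
    (hE : E ≤ E') (P : Ideal (𝓞 M)) [P.IsPrime] :
    (P.under (𝓞 E)).ramificationIdx (𝓞 F) ≤ (P.under (𝓞 E')).ramificationIdx (𝓞 F) := by
  have : FiniteDimensional F E :=
    Module.Finite.of_injective (IntermediateField.inclusion hE).toLinearMap
      (IntermediateField.inclusion hE).injective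
  have := numberField_of_finiteDimensional (F := F) E
  have := numberField_of_finiteDimensional (F := F) E'
  let : Algebra E E' := (IntermediateField.inclusion hE).toRingHom.toAlgebra
  have : IsScalarTower F E E' := .of_algebraMap_eq fun _ ↦ rfl
  have : IsScalarTower E E' M := .of_algebraMap_eq fun _ ↦ rfl
  have : (P.under (𝓞 E')).LiesOver (P.under (𝓞 E)) := inferInstance
  exact Ideal.ramificationIdx_below_le _ _

theorem ramificationIdx_under_pos (E : IntermediateField F M) [FiniteDimensional F E]
    (P : Ideal (𝓞 M)) [P.IsPrime] : 0 < (P.under (𝓞 E)).ramificationIdx (𝓞 F) := by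
  have := numberField_of_finiteDimensional (F := F) E
  exact Ideal.ramificationIdx_pos _ _

theorem inertiaDeg_under_pos (E : IntermediateField F M) [FiniteDimensional F E]
    (P : Ideal (𝓞 M)) [P.IsPrime] : 0 < (P.under (𝓞 E)).inertiaDeg (𝓞 F) := by
  have := numberField_of_finiteDimensional (F := F) E
  exact Ideal.inertiaDeg_pos _ _

/-- Enlarge each finite `E` to a finite Galois `E'`; there e ≤ ef, which is the order of the
decomposition group, and that group lifts injectively to `M`. -/
theorem ramIndex_le_card_decompositionSubgroup [IsGalois F M] (P : Ideal (𝓞 M)) [P.IsPrime]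
    (hP : P.under (𝓞 F) ≠ ⊥) [Finite (decompositionSubgroup F M P)] :
    ramIndex F P ≤ Nat.card (decompositionSubgroup F M P) := by
  refine iSup_le fun ⟨E, hE⟩ ↦ ?_
  obtain ⟨E', h1, h2, h3⟩ := exists_finite_galois_ge_intermediateField E
  refine Nat.cast_le.2 ((ramificationIdx_le_of_le h3 P).trans ?_)
  refine le_trans ?_ (card_decompositionSubgroup_under_le P E')
  rw [card_decompositionSubgroup_eq_mul]
  · exact Nat.le_mul_of_pos_right _ (inertiaDeg_under_pos E' P)
  · rwa [Ideal.under_under]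

/-- The map of residue fields induced by a subextension. -/
def residueInclusion (E : IntermediateField F M) (P : Ideal (𝓞 M)) :
    (𝓞 E ⧸ P.under (𝓞 E)) →ₗ[𝓞 F ⧸ P.under (𝓞 F)] 𝓞 M ⧸ P where
  toFun := algebraMap (𝓞 E ⧸ P.under (𝓞 E)) (𝓞 M ⧸ P)
  map_add' := map_add _
  map_smul' a x := by
    obtain ⟨a, rfl⟩ := Ideal.Quotient.mk_surjective a
    obtain ⟨x, rfl⟩ := Ideal.Quotient.mk_surjective x
    rw [Algebra.smul_def, Algebra.smul_def, map_mul]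
    congr 1

omit [NumberField F] in
theorem residueInclusion_injective (E : IntermediateField F M) (P : Ideal (𝓞 M)) :
    Function.Injective (residueInclusion (F := F) E P) :=
  FaithfulSMul.algebraMap_injective (𝓞 E ⧸ P.under (𝓞 E)) (𝓞 M ⧸ P)

theorem resDegree_le_card_decompositionSubgroup [IsGalois F M] (P : Ideal (𝓞 M)) [P.IsPrime]
    (hP : P.under (𝓞 F) ≠ ⊥) [Finite (decompositionSubgroup F M P)] :
    resDegree F P ≤ Nat.card (decompositionSubgroup F M P) := by
  have : (P.under (𝓞 F)).IsMaximal := Ring.DimensionLEOne.maximalOfPrime hP inferInstance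
  rw [resDegree, Cardinal.toENat_le_natCast]
  -- A finite independent set of residue classes has representatives in a finite Galois `E`, so its
  -- size is at most the inertia degree of `E`, hence at most the order of the decomposition group.
  refine rank_le fun s hs ↦ ?_
  choose g hg using Ideal.Quotient.mk_surjective (I := P)
  obtain ⟨E, h1, h2, h3⟩ :=
    exists_finite_galois_ge (F := F) ((fun x ↦ (g x : M)) '' (s : Set (𝓞 M ⧸ P)))
  have hmem : ∀ x : s, ∃ y : 𝓞 E ⧸ P.under (𝓞 E), residueInclusion (F := F) E P y = x := by
    intro x
    have hx : (g x : M) ∈ E := h3 ⟨x, x.2, rfl⟩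
    have hint : IsIntegral ℤ (⟨_, hx⟩ : E) :=
      (isIntegral_algebraMap_iff (algebraMap E M).injective).1 (g x).2
    refine ⟨Ideal.Quotient.mk _ ⟨⟨_, hx⟩, hint⟩, ?_⟩
    exact hg x
  choose y hy using hmem
  have hli : LinearIndependent (𝓞 F ⧸ P.under (𝓞 F)) y := by
    refine LinearIndependent.of_comp (residueInclusion (F := F) E P) ?_
    convert hs
    exact hy _
  have hunder : (P.under (𝓞 E)).LiesOver (P.under (𝓞 F)) := inferInstance
  have := finite_residueField_of_finiteDimensional (P.under (𝓞 E)) (P.under (𝓞 F))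
  have hc := hli.fintype_card_le_finrank
  rw [Fintype.card_coe, ← inertiaDeg_eq_finrank _ _ hP] at hc
  refine hc.trans (le_trans ?_ (card_decompositionSubgroup_under_le P E))
  rw [card_decompositionSubgroup_eq_mul]
  · exact Nat.le_mul_of_pos_left _ (ramificationIdx_under_pos E P)
  · rwa [Ideal.under_under]

theorem inertiaDeg_under_le_resDegree (E : IntermediateField F M) [FiniteDimensional F E]
    (P : Ideal (𝓞 M)) [P.IsPrime] (hP : P.under (𝓞 F) ≠ ⊥) :
    ((P.under (𝓞 E)).inertiaDeg (𝓞 F) : ℕ∞) ≤ resDegree F P := by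
  have : (P.under (𝓞 F)).IsMaximal := Ring.DimensionLEOne.maximalOfPrime hP inferInstance
  have := finite_residueField_of_finiteDimensional (P.under (𝓞 E)) (P.under (𝓞 F))
  rw [inertiaDeg_eq_finrank _ (P.under (𝓞 F)) hP, resDegree, ← map_natCast Cardinal.toENat,
    Module.finrank_eq_rank]
  exact OrderHomClass.mono Cardinal.toENat
    (LinearMap.rank_le_of_injective _ (residueInclusion_injective E P))

omit [NumberField F] in
theorem exists_finite_galois_injOn [IsGalois F M] (T : Set Gal(M/F)) [Finite T] :
    ∃ E : IntermediateField F M, FiniteDimensional F E ∧ IsGalois F E ∧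
      ∀ σ ∈ T, ∀ τ ∈ T, (∀ x : E, σ x = τ x) → σ = τ := by
  have h : ∀ st : T × T, ∃ x : M, st.1.1 x = st.2.1 x → st.1 = st.2 := by
    intro st
    by_contra! hc
    exact (hc 0).2 (Subtype.ext (AlgEquiv.ext fun x ↦ (hc x).1))
  choose x hx using h
  obtain ⟨E, h1, h2, h3⟩ := exists_finite_galois_ge (F := F) (Set.range x)
  exact ⟨E, h1, h2, fun σ hσ τ hτ hστ ↦ congrArg Subtype.val
    (hx (⟨σ, hσ⟩, ⟨τ, hτ⟩) (hστ ⟨_, h3 ⟨_, rfl⟩⟩))⟩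

/-- The decomposition group of a non-zero prime in a Galois extension is finite if and only if
its ramification index and its inertia degree are. -/
theorem finite_decompositionSubgroup_iff [IsGalois F M] (P : Ideal (𝓞 M)) [P.IsPrime]
    (hP : P.under (𝓞 F) ≠ ⊥) :
    Finite (decompositionSubgroup F M P) ↔ ramIndex F P ≠ ⊤ ∧ resDegree F P ≠ ⊤ := by
  refine ⟨fun h ↦ ⟨?_, ?_⟩, fun ⟨he, hf⟩ ↦ ?_⟩
  · exact ne_top_of_le_ne_top (ENat.natCast_ne_top _)
      (ramIndex_le_card_decompositionSubgroup P hP)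
  · exact ne_top_of_le_ne_top (ENat.natCast_ne_top _)
      (resDegree_le_card_decompositionSubgroup P hP)
  · by_contra hinf
    rw [not_finite_iff_infinite] at hinf
    lift ramIndex F P to ℕ using he with e he'
    lift resDegree F P to ℕ using hf with f hf'
    -- These `e * f + 1` elements stay distinct on some finite Galois `E`, whose decomposition group
    -- has order at most `e * f`.
    obtain ⟨T, hT⟩ := Infinite.exists_subset_card_eq (decompositionSubgroup F M P) (e * f + 1)
    obtain ⟨E, h1, h2, h3⟩ := exists_finite_galois_injOn (F := F)
      (Subtype.val '' (T : Set (decompositionSubgroup F M P)))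
    let r : T → decompositionSubgroup F E (P.under (𝓞 E)) := fun σ ↦
      ⟨AlgEquiv.restrictNormal σ.1.1 E, mem_decompositionSubgroup_under P σ.1.1 _
        (fun x ↦ (AlgEquiv.restrictNormal_commutes σ.1.1 E x).symm) σ.1.2⟩
    have hr : Function.Injective r := fun σ τ hστ ↦ by
      refine Subtype.ext (Subtype.ext (h3 _ ⟨σ.1, σ.2, rfl⟩ _ ⟨τ.1, τ.2, rfl⟩ fun x ↦ ?_))
      have h4 : AlgEquiv.restrictNormal σ.1.1 E = AlgEquiv.restrictNormal τ.1.1 E :=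
        congrArg Subtype.val hστ
      have h5 := AlgEquiv.restrictNormal_commutes σ.1.1 E x
      rw [h4, AlgEquiv.restrictNormal_commutes] at h5
      exact h5.symm
    have hcard := Nat.card_le_card_of_injective r hr
    rw [card_decompositionSubgroup_eq_mul _ (by rwa [Ideal.under_under])] at hcard
    have hE : (P.under (𝓞 E)).ramificationIdx (𝓞 F) ≤ e := by
      rw [← Nat.cast_le (α := ℕ∞), he']
      exact le_iSup (fun E : {E : IntermediateField F M // FiniteDimensional F E} ↦
        ((P.under (𝓞 E.1)).ramificationIdx (𝓞 F) : ℕ∞)) ⟨E, h1⟩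
    have hF : (P.under (𝓞 E)).inertiaDeg (𝓞 F) ≤ f := by
      rw [← Nat.cast_le (α := ℕ∞), hf']
      exact inertiaDeg_under_le_resDegree E P hP
    have := hcard.trans (Nat.mul_le_mul hE hF)
    simp only [Nat.card_eq_fintype_card, Fintype.card_coe, hT] at this
    omega

theorem ramIndex_ne_zero (P : Ideal (𝓞 M)) [P.IsPrime] : ramIndex F P ≠ 0 := by
  intro h
  have h1 := le_iSup (fun E : {E : IntermediateField F M // FiniteDimensional F E} ↦
    ((P.under (𝓞 E.1)).ramificationIdx (𝓞 F) : ℕ∞)) ⟨⊥, inferInstance⟩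
  have h2 := h1.trans h.le
  have h3 := ramificationIdx_under_pos (F := F) ⊥ P
  exact h3.ne' (by simpa using h2)

theorem resDegree_ne_zero (P : Ideal (𝓞 M)) [P.IsPrime] (hP : P.under (𝓞 F) ≠ ⊥) :
    resDegree F P ≠ 0 := by
  intro h
  have h2 := (inertiaDeg_under_le_resDegree (F := F) ⊥ P hP).trans h.le
  have h3 := inertiaDeg_under_pos (F := F) ⊥ P
  exact h3.ne' (by simpa using h2)

end FiniteLevel

/-! ### Invariance of e and f under isomorphism -/

section Transport

variable {A B C : Type*} [CommRing A] [CommRing B] [CommRing C] [Algebra A B] [Algebra A C]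

theorem comap_mem_primesOver (e : B ≃ₐ[A] C) {p : Ideal A} {P : Ideal C}
    (hP : P ∈ p.primesOver C) : P.comap e ∈ p.primesOver B := by
  have := hP.1
  refine ⟨Ideal.comap_isPrime _ _, ⟨?_⟩⟩
  rw [hP.2.over, Ideal.under_def, Ideal.under_def, ← Ideal.comap_coe e, Ideal.comap_comap]
  congr 1
  ext x
  exact (e.commutes x).symm

theorem ramificationIdx_comap_algEquiv [IsDomain A] [IsDedekindDomain B] [IsDedekindDomain C]
    [Module.IsTorsionFree A B] [Module.IsTorsionFree A C] (e : B ≃ₐ[A] C) {p : Ideal A} (hp : p ≠ ⊥)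
    {P : Ideal C} (hP : P ∈ p.primesOver C) :
    (P.comap e).ramificationIdx A = P.ramificationIdx A := by
  have := hP.1
  have := hP.2
  have := (comap_mem_primesOver e hP).1
  have := (comap_mem_primesOver e hP).2
  rw [← Ideal.ramificationIdx'_eq_ramificationIdx p P hp,
    ← Ideal.ramificationIdx'_eq_ramificationIdx p (P.comap e) hp]
  exact Ideal.ramificationIdx'_comap_eq p e P

theorem inertiaDeg_comap_algEquiv [Algebra.IsIntegral A B] [Algebra.IsIntegral A C]
    (e : B ≃ₐ[A] C) {p : Ideal A} [p.IsMaximal] {P : Ideal C} (hP : P ∈ p.primesOver C) :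
    (P.comap e).inertiaDeg A = P.inertiaDeg A := by
  have := hP.1
  have := hP.2
  have := (comap_mem_primesOver e hP).1
  have := (comap_mem_primesOver e hP).2
  have : P.IsMaximal := Ideal.IsMaximal.of_liesOver_isMaximal P p
  have : (P.comap e).IsMaximal := Ideal.IsMaximal.of_liesOver_isMaximal _ p
  rw [← Ideal.inertiaDeg'_eq_inertiaDeg p P, ← Ideal.inertiaDeg'_eq_inertiaDeg p (P.comap e)]
  exact Ideal.inertiaDeg'_comap_eq p e P

end Transport

/-! ### Maximal extensions with ramification and splitting conditions -/

section MaximalExtension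

variable {F M : Type*} [Field F] [NumberField F] [Field M] [Algebra F M]
  (S R : Set (HeightOneSpectrum (𝓞 F)))

theorem UnramifiedOutside.of_algEquiv {E E' : Type*} [Field E] [Field E'] [Algebra F E]
    [Algebra F E'] [FiniteDimensional F E] (e : E ≃ₐ[F] E') {S : Set (HeightOneSpectrum (𝓞 F))}
    (h : UnramifiedOutside F E S) : UnramifiedOutside F E' S := by
  have : FiniteDimensional F E' := e.toLinearEquiv.finiteDimensional
  have := numberField_of_finiteDimensional (F := F) E
  have := numberField_of_finiteDimensional (F := F) E'
  intro p hp P hP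
  rw [← ramificationIdx_comap_algEquiv (NumberField.RingOfIntegers.mapAlgEquiv e) p.ne_bot hP]
  exact h p hp _ (comap_mem_primesOver _ hP)

theorem CompletelySplitAt.of_algEquiv {E E' : Type*} [Field E] [Field E'] [Algebra F E]
    [Algebra F E'] [FiniteDimensional F E] (e : E ≃ₐ[F] E') {R : Set (HeightOneSpectrum (𝓞 F))}
    (h : CompletelySplitAt F E R) : CompletelySplitAt F E' R := by
  have : FiniteDimensional F E' := e.toLinearEquiv.finiteDimensional
  have := numberField_of_finiteDimensional (F := F) E
  have := numberField_of_finiteDimensional (F := F) E'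
  intro p hp P hP
  have := p.isMaximal
  rw [← ramificationIdx_comap_algEquiv (NumberField.RingOfIntegers.mapAlgEquiv e) p.ne_bot hP,
    ← inertiaDeg_comap_algEquiv (NumberField.RingOfIntegers.mapAlgEquiv e) hP]
  exact h p hp _ (comap_mem_primesOver _ hP)

/-- Conjugation over `F` permutes the finite subextensions in the compositum, since both defining
conditions are isomorphism invariant. -/
instance normal_maxExt [Normal F M] : Normal F (maxExt F M S R) := by
  rw [IntermediateField.normal_iff_forall_map_le']
  intro σ
  rw [maxExt, IntermediateField.map_iSup]
  refine iSup_le fun ⟨E, h1, h2, h3⟩ ↦ ?_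
  let e := E.equivMap (σ : M →ₐ[F] M)
  exact le_iSup (fun E : {E : IntermediateField F M //
    FiniteDimensional F E ∧ UnramifiedOutside F E S ∧ CompletelySplitAt F E R} ↦ E.1)
    ⟨E.map (σ : M →ₐ[F] M), e.toLinearEquiv.finiteDimensional, h2.of_algEquiv e,
      h3.of_algEquiv e⟩

/-- The decomposition group of a completely split prime acts trivially. -/
theorem decompositionSubgroup_le_fixingSubgroup [IsGalois F M] (E : IntermediateField F M)
    [FiniteDimensional F E] (p : HeightOneSpectrum (𝓞 F)) (hE : CompletelySplitAt F E {p})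
    (P : Ideal (𝓞 M)) (hP : P ∈ p.asIdeal.primesOver (𝓞 M)) :
    decompositionSubgroup F M P ≤ E.fixingSubgroup := by
  have := numberField_of_finiteDimensional (F := F) E
  have := p.isMaximal
  have := hP.1
  have hfin : (p.asIdeal.primesOver (𝓞 E)).Finite :=
    IsDedekindDomain.primesOver_finite p.asIdeal (𝓞 E)
  let : Fintype (p.asIdeal.primesOver (𝓞 E)) := hfin.fintype
  have hcard : Nat.card (p.asIdeal.primesOver (𝓞 E)) = Module.finrank F E := by
    have := Ideal.sum_ramification_inertia_eq_finrank p.asIdeal (𝓞 E)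
    rw [Finset.sum_congr rfl fun q _ ↦ by
      rw [(hE p rfl q.1 q.2).1, (hE p rfl q.1 q.2).2, one_mul]] at this
    rw [IsFractionRing.finrank_eq (𝓞 F) F (𝓞 E) E, ← this]
    simp
  -- Pull `P` back along each embedding of `E`. By transitivity every prime above `p` arises;
  -- complete splitting gives [E:F] of them and there are at most [E:F] embeddings, so `c` is
  -- bijective. An element of the decomposition group does not change the prime pulled back, hence
  -- not the embedding. `E` need not be Galois.
  let c : (E →ₐ[F] M) → p.asIdeal.primesOver (𝓞 E) := fun φ ↦
    ⟨P.comap (NumberField.RingOfIntegers.mapAlgHom φ), Ideal.comap_isPrime _ _, ⟨by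
      rw [hP.2.over, Ideal.under_def, Ideal.under_def, ← Ideal.comap_coe
        (NumberField.RingOfIntegers.mapAlgHom φ), Ideal.comap_comap]
      congr 1
      exact (NumberField.RingOfIntegers.mapAlgHom φ).comp_algebraMap.symm⟩⟩
  have hsurj : Function.Surjective c := by
    intro ⟨q, hq⟩
    have := hq.1
    have : Algebra.IsAlgebraic E M := Algebra.IsAlgebraic.tower_top (K := F) E
    obtain ⟨Q, hQ, hQq⟩ := exists_prime_under_eq (B := M) q
    obtain ⟨σ, hσ⟩ := exists_smul_eq_of_under_eq (F := F) P Q (by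
      rw [← hP.2.over, ← Ideal.under_under (B := 𝓞 E) Q, hQq, ← hq.2.over])
    refine ⟨(σ⁻¹ : Gal(M/F)).toAlgHom.comp E.val, Subtype.ext ?_⟩
    change P.comap _ = q
    rw [← hQq]
    ext x
    rw [Ideal.mem_comap, Ideal.mem_under, hσ, Ideal.mem_pointwise_smul_iff_inv_smul_mem]
    rfl
  have hinj : Function.Injective c := by
    have : Finite (E →ₐ[F] M) := inferInstance
    refine (hsurj.bijective_of_nat_card_le ?_).1
    rw [hcard]
    exact card_algHom_le_finrank F E M
  intro σ hσ
  rw [IntermediateField.mem_fixingSubgroup_iff]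
  intro x hx
  have hc : c ((σ : M →ₐ[F] M).comp E.val) = c E.val := by
    refine Subtype.ext ?_
    change P.comap _ = P.comap _
    ext y
    rw [Ideal.mem_comap, Ideal.mem_comap]
    conv_rhs => rw [← Ideal.smul_mem_pointwise_smul_iff (a := σ), show σ • P = P from hσ]
    rfl
  exact DFunLike.congr_fun (hinj hc) (⟨x, hx⟩ : E)

theorem decompositionSubgroup_le_fixingSubgroup_maxExt [IsGalois F M]
    (p : HeightOneSpectrum (𝓞 F)) (P : Ideal (𝓞 M)) (hP : P ∈ p.asIdeal.primesOver (𝓞 M)) :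
    decompositionSubgroup F M P ≤ (maxExt F M S {p}).fixingSubgroup := by
  rw [← IntermediateField.le_iff_le, maxExt]
  refine iSup_le fun ⟨E, h1, h2, h3⟩ ↦ ?_
  rw [IntermediateField.le_iff_le]
  exact decompositionSubgroup_le_fixingSubgroup E p h3 P hP

end MaximalExtension

/-! ### Independence of the chosen prolongation -/

section Conjugation

variable {F N : Type*} [Field F] [Field N] [Algebra F N] [IsGalois F N]

theorem relIndex_decompositionSubgroup_congr (J : Subgroup Gal(N/F)) [J.Normal]
    (P Q : Ideal (𝓞 N)) [P.IsPrime] [Q.IsPrime] (h : P.under (𝓞 F) = Q.under (𝓞 F)) :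
    J.relIndex (decompositionSubgroup F N P) = J.relIndex (decompositionSubgroup F N Q) := by
  obtain ⟨σ, rfl⟩ := exists_smul_eq_of_under_eq P Q h
  have hD : decompositionSubgroup F N (σ • P) =
      (decompositionSubgroup F N P).map (MulAut.conj σ).toMonoidHom :=
    MulAction.stabilizer_smul_eq_stabilizer_map_conj σ P
  rw [hD, ← Subgroup.relIndex_comap]
  congr 1
  ext τ
  have hJ : J.Normal := inferInstance
  refine ⟨fun h ↦ hJ.conj_mem τ h σ, fun h ↦ ?_⟩
  simpa [mul_assoc] using hJ.conj_mem _ h σ⁻¹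

omit [IsGalois F N] in
theorem normal_fixingSubgroup (M : IntermediateField F N) [Normal F M] :
    M.fixingSubgroup.Normal := by
  rw [← IntermediateField.restrictNormalHom_ker]
  infer_instance

end Conjugation

/-! ### Positivity and cancellation in β -/

section BetaTerm

variable {F M : Type*} [Field F] [NumberField F] [Field M] [Algebra F M]

theorem one_lt_primeNorm (p : HeightOneSpectrum (𝓞 F)) : 1 < primeNorm p := by
  have := p.isPrime
  have : Finite (𝓞 F ⧸ p.asIdeal) := Ring.HasFiniteQuotients.finiteQuotient p.ne_bot
  exact Finite.one_lt_card

omit [NumberField F] in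
theorem betaTerm_ne_top (p : HeightOneSpectrum (𝓞 F)) : betaTerm M p ≠ ⊤ := by
  unfold betaTerm
  split_ifs
  · exact ENNReal.ofReal_ne_top
  · exact ENNReal.zero_ne_top

omit [NumberField F] in
theorem under_prolongation (p : HeightOneSpectrum (𝓞 F)) :
    (prolongation M p).under (𝓞 F) = p.asIdeal :=
  ((Classical.arbitrary (p.asIdeal.primesOver (𝓞 M))).2.2.over).symm

instance isPrime_prolongation [Algebra.IsAlgebraic F M] (p : HeightOneSpectrum (𝓞 F)) :
    (prolongation M p).IsPrime :=
  (Classical.arbitrary (p.asIdeal.primesOver (𝓞 M))).2.1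

/-- The contribution of a prime to `β` is non-zero if and only if its decomposition group is
finite. -/
theorem betaTerm_ne_zero_iff [IsGalois F M] (p : HeightOneSpectrum (𝓞 F)) :
    betaTerm M p ≠ 0 ↔ Finite (decompositionSubgroup F M (prolongation M p)) := by
  have hp : (prolongation M p).under (𝓞 F) ≠ ⊥ := by
    rw [under_prolongation]
    exact p.ne_bot
  rw [finite_decompositionSubgroup_iff _ hp]
  change betaTerm M p ≠ 0 ↔ eIndex M p ≠ ⊤ ∧ fDegree M p ≠ ⊤
  unfold betaTerm
  split_ifs with h
  · refine iff_of_true ?_ h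
    -- `toNat` is zero at `⊤` as well as at `0`, so both must be excluded before the coefficient is
    -- known to be positive.
    have he : 0 < (eIndex M p).toNat :=
      Nat.pos_of_ne_zero fun h0 ↦ (ENat.toNat_eq_zero.1 h0).elim
        (ramIndex_ne_zero _) h.1
    have hf : (fDegree M p).toNat ≠ 0 := fun h0 ↦ (ENat.toNat_eq_zero.1 h0).elim
        (resDegree_ne_zero _ hp) h.2
    rw [Ne, ENNReal.ofReal_eq_zero, not_le]
    have hN : (1 : ℝ) < (primeNorm p : ℝ) ^ (fDegree M p).toNat :=
      one_lt_pow₀ (by exact_mod_cast one_lt_primeNorm p) hf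
    have hf' : 0 < (fDegree M p).toNat := Nat.pos_of_ne_zero hf
    refine mul_pos (by positivity) (Real.log_pos ?_)
    rw [one_lt_div (by linarith)]
    linarith
  · simp [h]

theorem finite_primesAbove (K L : Type*) [Field K] [NumberField K] [Field L] [Algebra K L]
    [FiniteDimensional K L] {S : Set (HeightOneSpectrum (𝓞 K))} (hS : S.Finite) :
    (primesAbove K L S).Finite := by
  have := numberField_of_finiteDimensional (F := K) L
  refine Set.Finite.subset (hS.biUnion (t := fun p ↦
    HeightOneSpectrum.asIdeal ⁻¹' p.asIdeal.primesOver (𝓞 L)) fun p _ ↦ ?_) ?_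
  · have := p.isMaximal
    exact (IsDedekindDomain.primesOver_finite p.asIdeal (𝓞 L)).preimage
      fun P _ Q _ h ↦ HeightOneSpectrum.ext h
  · rintro P ⟨p, hp, hP⟩
    exact Set.mem_biUnion hp ⟨P.isPrime, hP⟩

omit [NumberField F] in
-- Finiteness of `T` makes the sum over `T` finite, which is what permits cancelling it in [0, ∞]; a
-- vanishing sum of non-negative terms then vanishes termwise.
theorem beta_eq_tsum_subtype_iff {T : Set (HeightOneSpectrum (𝓞 F))} (hT : T.Finite) :
    beta F M = ∑' p : T, betaTerm M p.1 ↔ ∀ p ∉ T, betaTerm M p = 0 := by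
  have : Finite T := hT
  have hfin : ∑' p : T, betaTerm M p.1 ≠ ⊤ := by
    let := Fintype.ofFinite T
    rw [tsum_fintype]
    exact ENNReal.sum_ne_top.2 fun p _ ↦ betaTerm_ne_top p.1
  have hsplit : beta F M =
      ∑' p : T, betaTerm M p.1 + ∑' p : (Tᶜ : Set _), betaTerm M p.1 :=
    (ENNReal.summable.tsum_add_tsum_compl ENNReal.summable).symm
  rw [hsplit]
  refine Iff.trans (b := ∑' p : (Tᶜ : Set _), betaTerm M p.1 = 0) ⟨fun h ↦ ?_, fun h ↦ ?_⟩ ?_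
  · exact (ENNReal.add_right_inj hfin).1 (h.trans (add_zero _).symm)
  · rw [h, add_zero]
  · rw [ENNReal.tsum_eq_zero]
    exact ⟨fun h p hp ↦ h ⟨p, hp⟩, fun h p ↦ h p.1 p.2⟩

end BetaTerm

/-! ### From Gal(K_S/L) to the open subgroup U, and the two equivalences -/

section Global

variable {K : Type*} [Field K] [NumberField K] (S : Set (HeightOneSpectrum (𝓞 K)))

instance isGalois_KS : IsGalois K (KS K S) where

variable {S} (U : Subgroup (GKS S))

/-- The inclusion of `Gal(K_S/K_S^U)` into `G_{K,S}`. -/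
abbrev galInclusion : Gal(KS K S/fixedKS S U) →* GKS S := AlgEquiv.restrictScalarsHom K

omit [NumberField K] in
theorem decompositionSubgroup_comap_galInclusion (P : Ideal (𝓞 (KS K S))) :
    (decompositionSubgroup K (KS K S) P).comap (galInclusion U) =
      decompositionSubgroup (fixedKS S U) (KS K S) P := rfl

omit [NumberField K] in
theorem fixingSubgroup_restrictScalars_comap
    (M : IntermediateField (fixedKS S U) (KS K S)) :
    (M.restrictScalars K).fixingSubgroup.comap (galInclusion U) = M.fixingSubgroup := by
  ext σ
  rw [Subgroup.mem_comap, IntermediateField.mem_fixingSubgroup_iff,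
    IntermediateField.mem_fixingSubgroup_iff]
  rfl

theorem fixingSubgroup_fixedField_of_isClosed {H : Subgroup (GKS S)}
    (hH : IsClosed (H : Set (GKS S))) : (IntermediateField.fixedField H).fixingSubgroup = H :=
  InfiniteGalois.fixingSubgroup_fixedField ⟨H, hH⟩

theorem fixingSubgroup_fixedKSOver {H : Subgroup (GKS S)} (hHU : H ≤ U)
    (hH : IsClosed (H : Set (GKS S))) :
    (fixedKSOver S hHU).fixingSubgroup = H.comap (galInclusion U) := by
  rw [← fixingSubgroup_restrictScalars_comap]
  conv_rhs => rw [← fixingSubgroup_fixedField_of_isClosed hH]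
  rfl

variable {U} (hU : IsOpen (U : Set (GKS S)))
include hU

theorem range_galInclusion : (galInclusion U).range = U := by
  ext σ
  refine ⟨?_, fun hσ ↦ ?_⟩
  · rintro ⟨τ, rfl⟩
    have : galInclusion U τ ∈ (IntermediateField.fixedField U).fixingSubgroup := by
      rw [IntermediateField.mem_fixingSubgroup_iff]
      exact fun x hx ↦ τ.commutes ⟨x, hx⟩
    rwa [fixingSubgroup_fixedField_of_isClosed (Subgroup.isClosed_of_isOpen U hU)] at this
  · exact ⟨AlgEquiv.ofRingEquiv (f := σ.toRingEquiv) fun x ↦ x.2 ⟨σ, hσ⟩, rfl⟩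

theorem finiteDimensional_fixedKS : FiniteDimensional K (fixedKS S U) := by
  rw [← InfiniteGalois.isOpen_iff_finite]
  change IsOpen ((IntermediateField.fixedField U).fixingSubgroup : Set (GKS S))
  rwa [fixingSubgroup_fixedField_of_isClosed (Subgroup.isClosed_of_isOpen U hU)]

theorem normal_comap_galInclusion_iff (H : Subgroup (GKS S)) :
    (H.subgroupOf U).Normal ↔ (H.comap (galInclusion U)).Normal := by
  refine ⟨fun h ↦ ⟨fun τ hτ σ ↦ ?_⟩, fun h ↦ ⟨fun ⟨τ, hτU⟩ hτ ⟨σ, hσU⟩ ↦ ?_⟩⟩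
  · have hmem : ∀ ρ, galInclusion U ρ ∈ U := fun ρ ↦ by
      have : galInclusion U ρ ∈ (galInclusion U).range := ⟨ρ, rfl⟩
      rwa [range_galInclusion hU] at this
    rw [Subgroup.mem_comap, map_mul, map_mul, map_inv]
    exact h.conj_mem ⟨_, hmem τ⟩ hτ ⟨_, hmem σ⟩
  · rw [← range_galInclusion hU] at hτU hσU
    obtain ⟨τ, rfl⟩ := hτU
    obtain ⟨σ, rfl⟩ := hσU
    have := h.conj_mem τ hτ σ
    rwa [Subgroup.mem_comap, map_mul, map_mul, map_inv] at this

/-- In a compact group a closed subgroup is open iff its index is finite. Normality of `H` enters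
only afterwards, in replacing "some P" by "any P". -/
theorem liesUnder_iff_exists {H : Subgroup (GKS S)} (hH : IsClosed (H : Set (GKS S)))
    (p : HeightOneSpectrum (𝓞 (fixedKS S U))) :
    LiesUnder S U H p ↔ ∃ P ∈ p.asIdeal.primesOver (𝓞 (KS K S)),
      (H.comap (galInclusion U)).relIndex
        (decompositionSubgroup (fixedKS S U) (KS K S) P) ≠ 0 := by
  refine exists_congr fun P ↦ and_congr_right fun _ ↦ ?_
  have hD : IsClosed ((decompositionSubgroup K (KS K S) P ⊓ U : Subgroup (GKS S)) :
      Set (GKS S)) :=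
    (isClosed_decompositionSubgroup P).inter (Subgroup.isClosed_of_isOpen U hU)
  rw [Subgroup.relIndex_comap, ← decompositionSubgroup_comap_galInclusion,
    Subgroup.map_comap_eq, range_galInclusion hU, inf_comm U]
  generalize decompositionSubgroup K (KS K S) P ⊓ U = D at hD
  have : CompactSpace D := isCompact_iff_compactSpace.1 hD.isCompact
  refine ⟨fun h ↦ ?_, fun h ↦ ?_⟩
  · have := Subgroup.quotient_finite_of_isOpen _ h
    exact Subgroup.index_ne_zero_of_finite
  · have : (H.subgroupOf D).FiniteIndex := ⟨h⟩
    exact Subgroup.isOpen_of_isClosed_of_finiteIndex _ (hH.preimage continuous_subtype_val)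

theorem liesUnder_iff {H : Subgroup (GKS S)} (hH : IsClosed (H : Set (GKS S)))
    (hHn : (H.subgroupOf U).Normal) (p : HeightOneSpectrum (𝓞 (fixedKS S U)))
    {P : Ideal (𝓞 (KS K S))} (hP : P ∈ p.asIdeal.primesOver (𝓞 (KS K S))) :
    LiesUnder S U H p ↔ (H.comap (galInclusion U)).relIndex
      (decompositionSubgroup (fixedKS S U) (KS K S) P) ≠ 0 := by
  rw [liesUnder_iff_exists hU hH]
  refine ⟨?_, fun h ↦ ⟨P, hP, h⟩⟩
  rintro ⟨Q, hQ, h⟩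
  have := (normal_comap_galInclusion_iff hU H).1 hHn
  have := hP.1
  have := hQ.1
  rwa [relIndex_decompositionSubgroup_congr _ P Q (hP.2.over.symm.trans hQ.2.over)]

omit [NumberField K] hU in
theorem exists_mem_primesOver (p : HeightOneSpectrum (𝓞 (fixedKS S U))) :
    ∃ P, P ∈ p.asIdeal.primesOver (𝓞 (KS K S)) := by
  have := p.isPrime
  obtain ⟨P, h1, h2⟩ := exists_prime_under_eq (B := KS K S) p.asIdeal
  exact ⟨P, h1, ⟨h2.symm⟩⟩

theorem betaTerm_ne_zero_iff_liesUnder {H : Subgroup (GKS S)} (hHU : H ≤ U)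
    (hH : IsClosed (H : Set (GKS S))) (hHn : (H.subgroupOf U).Normal)
    (p : HeightOneSpectrum (𝓞 (fixedKS S U))) :
    betaTerm (fixedKSOver S hHU) p ≠ 0 ↔ LiesUnder S U H p := by
  have := finiteDimensional_fixedKS hU
  have := numberField_of_finiteDimensional (F := K) (fixedKS S U)
  have := (normal_comap_galInclusion_iff hU H).1 hHn
  rw [← fixingSubgroup_fixedKSOver U hHU hH] at this
  have : IsGalois (fixedKS S U) (fixedKSOver S hHU) :=
    (InfiniteGalois.normal_iff_isGalois _).1 this
  -- β uses a chosen prolongation to K_S^H; `P` is taken above it, so that the quotient description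
  -- of decomposition groups applies to that very prime.
  obtain ⟨P, hP, hPu⟩ :=
    exists_prime_under_eq (B := KS K S) (prolongation (fixedKSOver S hHU) p)
  have hPp : P ∈ p.asIdeal.primesOver (𝓞 (KS K S)) := by
    refine ⟨hP, ⟨?_⟩⟩
    rw [← under_prolongation (M := fixedKSOver S hHU) p, ← hPu, Ideal.under_under]
  rw [betaTerm_ne_zero_iff, liesUnder_iff hU hH hHn p hPp, ← fixingSubgroup_fixedKSOver U hHU hH,
    ← hPu]
  exact ⟨relIndex_decompositionSubgroup_ne_zero _ P, finite_decompositionSubgroup_under _ P⟩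

omit hU [NumberField K] in
theorem zCount_eq_zero_iff (H : Subgroup (GKS S)) :
    zCount S U H = 0 ↔ ∀ p ∉ primesAbove K (fixedKS S U) S, ¬ LiesUnder S U H p := by
  rw [zCount, Set.encard_eq_zero, Set.eq_empty_iff_forall_notMem]
  simp

theorem zCount_eq_zero_iff_beta_eq (hS : S.Finite) {H : Subgroup (GKS S)} (hHU : H ≤ U)
    (hH : IsClosed (H : Set (GKS S))) (hHn : (H.subgroupOf U).Normal) :
    zCount S U H = 0 ↔ beta (fixedKS S U) (fixedKSOver S hHU) =
      ∑' p : primesAbove K (fixedKS S U) S, betaTerm (fixedKSOver S hHU) p.1 := by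
  have := finiteDimensional_fixedKS hU
  have := numberField_of_finiteDimensional (F := K) (fixedKS S U)
  rw [beta_eq_tsum_subtype_iff (finite_primesAbove K (fixedKS S U) hS), zCount_eq_zero_iff]
  refine forall₂_congr fun p _ ↦ ?_
  rw [← betaTerm_ne_zero_iff_liesUnder hU hHU hH hHn, not_not]

theorem one_lt_zCount_of_inf {H H₁ H₂ : Subgroup (GKS S)} (hH : IsClosed (H : Set (GKS S)))
    (hHn : (H.subgroupOf U).Normal)
    (hle₁ : H₁ ≤ H) (hc₁ : IsClosed (H₁ : Set (GKS S))) (hn₁ : (H₁.subgroupOf U).Normal)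
    (hz₁ : 0 < zCount S U H₁)
    (hle₂ : H₂ ≤ H) (hc₂ : IsClosed (H₂ : Set (GKS S))) (hn₂ : (H₂.subgroupOf U).Normal)
    (hz₂ : 0 < zCount S U H₂) (hz : zCount S U (H₁ ⊓ H₂) = 0) : 1 < zCount S U H := by
  obtain ⟨p₁, hpS₁, hp₁⟩ := Set.encard_pos.1 hz₁
  obtain ⟨p₂, hpS₂, hp₂⟩ := Set.encard_pos.1 hz₂
  obtain ⟨P₁, hP₁⟩ := exists_mem_primesOver p₁
  obtain ⟨P₂, hP₂⟩ := exists_mem_primesOver p₂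
  have mono : ∀ {H' : Subgroup (GKS S)} {D : Subgroup Gal(KS K S/fixedKS S U)}, H' ≤ H →
      (H'.comap (galInclusion U)).relIndex D ≠ 0 →
        (H.comap (galInclusion U)).relIndex D ≠ 0 := fun hle h0 h ↦
    h0 (Nat.eq_zero_of_zero_dvd (h ▸ Subgroup.relIndex_dvd_of_le_left _ (Subgroup.comap_mono hle)))
  rw [liesUnder_iff hU hc₁ hn₁ p₁ hP₁] at hp₁
  rw [liesUnder_iff hU hc₂ hn₂ p₂ hP₂] at hp₂
  refine Set.one_lt_encard_iff.2 ⟨p₁, p₂, ⟨hpS₁, ?_⟩, ⟨hpS₂, ?_⟩, ?_⟩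
  · exact (liesUnder_iff hU hH hHn p₁ hP₁).2 (mono hle₁ hp₁)
  · exact (liesUnder_iff hU hH hHn p₂ hP₂).2 (mono hle₂ hp₂)
  -- A common prime would lie under `H₁ ⊓ H₂`: normality of `H₂` moves its condition from `P₂` to
  -- `P₁`, and two finite relative indices give a finite one for the intersection.
  · rintro rfl
    rw [← liesUnder_iff hU hc₂ hn₂ p₁ hP₂, liesUnder_iff hU hc₂ hn₂ p₁ hP₁] at hp₂
    refine (zCount_eq_zero_iff _).1 hz p₁ hpS₁
      ((liesUnder_iff_exists hU (hc₁.inter hc₂) p₁).2 ⟨P₁, hP₁, ?_⟩)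
    rw [Subgroup.comap_inf]
    exact Subgroup.relIndex_inf_ne_zero hp₁ hp₂

/-- The subgroup of `G_{K,S}` fixing the maximal extension of `K_S^U` unramified outside `S` and
completely split in `p`. -/
def splitSubgroup (p : HeightOneSpectrum (𝓞 (fixedKS S U))) : Subgroup (GKS S) :=
  ((maxExt (fixedKS S U) (KS K S) (primesAbove K (fixedKS S U) S) {p}).restrictScalars
    K).fixingSubgroup

omit hU [NumberField K] in
theorem splitSubgroup_comap (p : HeightOneSpectrum (𝓞 (fixedKS S U))) :
    (splitSubgroup p).comap (galInclusion U) =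
      (maxExt (fixedKS S U) (KS K S) (primesAbove K (fixedKS S U) S) {p}).fixingSubgroup :=
  fixingSubgroup_restrictScalars_comap U _

/-- This isolates `p`: the added factor contains all decomposition groups above `p`, while any other
prime under it would have finite decomposition group in the extension split at `p`, against (C3). -/
theorem exists_inf_of_liesUnder (hC3 : ConditionC3 S) {H : Subgroup (GKS S)}
    (hH : IsClosed (H : Set (GKS S))) (hHn : (H.subgroupOf U).Normal)
    {p : HeightOneSpectrum (𝓞 (fixedKS S U))} (hpS : p ∉ primesAbove K (fixedKS S U) S)
    (hp : LiesUnder S U H p) :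
    IsClosed ((H ⊓ splitSubgroup p : Subgroup (GKS S)) : Set (GKS S)) ∧
      ((H ⊓ splitSubgroup p).subgroupOf U).Normal ∧ 0 < zCount S U (H ⊓ splitSubgroup p) ∧
      ∀ q, LiesUnder S U (H ⊓ splitSubgroup p) q → q = p := by
  have := finiteDimensional_fixedKS hU
  have := numberField_of_finiteDimensional (F := K) (fixedKS S U)
  set M := maxExt (fixedKS S U) (KS K S) (primesAbove K (fixedKS S U) S) {p} with hM
  have : M.fixingSubgroup.Normal := normal_fixingSubgroup M
  have hcl : IsClosed ((H ⊓ splitSubgroup p : Subgroup (GKS S)) : Set (GKS S)) :=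
    hH.inter (InfiniteGalois.fixingSubgroup_isClosed _)
  have hcomap : (H ⊓ splitSubgroup p).comap (galInclusion U) =
      H.comap (galInclusion U) ⊓ M.fixingSubgroup := by
    rw [Subgroup.comap_inf, splitSubgroup_comap]
  have hn : ((H ⊓ splitSubgroup p).subgroupOf U).Normal := by
    have := (normal_comap_galInclusion_iff hU H).1 hHn
    rw [normal_comap_galInclusion_iff hU, hcomap]
    infer_instance
  refine ⟨hcl, hn, Set.encard_pos.2 ⟨p, hpS, ?_⟩, fun q hq ↦ ?_⟩
  · obtain ⟨P, hP⟩ := exists_mem_primesOver p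
    rw [liesUnder_iff hU hcl hn p hP, hcomap]
    rw [liesUnder_iff hU hH hHn p hP] at hp
    refine Subgroup.relIndex_inf_ne_zero hp ?_
    rw [Subgroup.relIndex_eq_one.2 (decompositionSubgroup_le_fixingSubgroup_maxExt _ p P hP)]
    exact one_ne_zero
  · by_contra hqp
    obtain ⟨Q, hQ⟩ := exists_mem_primesOver q
    rw [liesUnder_iff hU hcl hn q hQ, hcomap] at hq
    have hq' : M.fixingSubgroup.relIndex
        (decompositionSubgroup (fixedKS S U) (KS K S) Q) ≠ 0 := fun h ↦
      hq (Nat.eq_zero_of_zero_dvd (h ▸ Subgroup.relIndex_dvd_of_le_left _ inf_le_right))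
    have := hQ.1
    have hQM : Q.under (𝓞 M) ∈ q.asIdeal.primesOver (𝓞 M) := by
      refine ⟨inferInstance, ⟨?_⟩⟩
      rw [Ideal.under_under]
      exact hQ.2.over
    exact not_finite_iff_infinite.2 (hC3 (fixedKS S U) inferInstance p q (Ne.symm hqp) _ hQM)
      (finite_decompositionSubgroup_under M Q hq')

/-- If at least two primes outside `S` lie under `H`, then `H` contains two normal subgroups which
have primes lying under them, but no prime outside `S` lying under both. -/
theorem exists_of_one_lt_zCount (hC3 : ConditionC3 S) {H : Subgroup (GKS S)}
    (hH : IsClosed (H : Set (GKS S))) (hHn : (H.subgroupOf U).Normal)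
    (hz : 1 < zCount S U H) :
    ∃ H₁ H₂ : Subgroup (GKS S),
      (H₁ ≤ H ∧ IsClosed (H₁ : Set (GKS S)) ∧ (H₁.subgroupOf U).Normal ∧ 0 < zCount S U H₁) ∧
      (H₂ ≤ H ∧ IsClosed (H₂ : Set (GKS S)) ∧ (H₂.subgroupOf U).Normal ∧ 0 < zCount S U H₂) ∧
      zCount S U (H₁ ⊓ H₂) = 0 := by
  obtain ⟨p, q, ⟨hpS, hp⟩, ⟨hqS, hq⟩, hpq⟩ := Set.one_lt_encard_iff.1 hz
  obtain ⟨hc₁, hn₁, hz₁, hu₁⟩ := exists_inf_of_liesUnder hU hC3 hH hHn hpS hp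
  obtain ⟨hc₂, hn₂, hz₂, hu₂⟩ := exists_inf_of_liesUnder hU hC3 hH hHn hqS hq
  refine ⟨_, _, ⟨inf_le_left, hc₁, hn₁, hz₁⟩, ⟨inf_le_left, hc₂, hn₂, hz₂⟩,
    (zCount_eq_zero_iff _).2 fun r _ hr ↦ hpq ?_⟩
  obtain ⟨P, hP, h⟩ := (liesUnder_iff_exists hU (hc₁.inter hc₂) r).1 hr
  have mono : ∀ {H' : Subgroup (GKS S)}, H ⊓ splitSubgroup p ⊓ (H ⊓ splitSubgroup q) ≤ H' →
      (H'.comap (galInclusion U)).relIndex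
        (decompositionSubgroup (fixedKS S U) (KS K S) P) ≠ 0 := fun hle h0 ↦
    h (Nat.eq_zero_of_zero_dvd (h0 ▸ Subgroup.relIndex_dvd_of_le_left _ (Subgroup.comap_mono hle)))
  -- A prime `r` under the intersection lies under both factors, so it equals both `p` and `q`.
  rw [← hu₁ r ((liesUnder_iff_exists hU hc₁ r).2 ⟨P, hP, mono inf_le_left⟩)]
  exact hu₂ r ((liesUnder_iff_exists hU hc₂ r).2 ⟨P, hP, mono inf_le_right⟩)

end Global

end ArithCurve

end


theorem proposition4 (K : Type*) [Field K] [NumberField K]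
    (S : Set (IsDedekindDomain.HeightOneSpectrum (NumberField.RingOfIntegers K))) (hS : S.Finite)
    (hC3 : ArithCurve.ConditionC3 S)
    (U : Subgroup (ArithCurve.GKS S)) (hU : IsOpen (U : Set (ArithCurve.GKS S)))
    (H : Subgroup (ArithCurve.GKS S)) (hHU : H ≤ U) (hHnormal : (H.subgroupOf U).Normal)
    (hHclosed : IsClosed (H : Set (ArithCurve.GKS S)))
    (hHnotopen : ¬ IsOpen (H : Set (ArithCurve.GKS S))) :
    (ArithCurve.zCount S U H = 0 ↔
      ArithCurve.beta (ArithCurve.fixedKS S U) (ArithCurve.fixedKSOver S hHU) =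
        ∑' p : ArithCurve.primesAbove K (ArithCurve.fixedKS S U) S,
          ArithCurve.betaTerm (ArithCurve.fixedKSOver S hHU) p.1) ∧
    (1 < ArithCurve.zCount S U H ↔
      ∃ H₁ H₂ : Subgroup (ArithCurve.GKS S),
        (H₁ ≤ H ∧ IsClosed (H₁ : Set (ArithCurve.GKS S)) ∧ (H₁.subgroupOf U).Normal ∧
          0 < ArithCurve.zCount S U H₁) ∧
        (H₂ ≤ H ∧ IsClosed (H₂ : Set (ArithCurve.GKS S)) ∧ (H₂.subgroupOf U).Normal ∧
          0 < ArithCurve.zCount S U H₂) ∧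
        ArithCurve.zCount S U (H₁ ⊓ H₂) = 0) := by
  refine ⟨ArithCurve.zCount_eq_zero_iff_beta_eq hU hS hHU hHclosed hHnormal,
    ArithCurve.exists_of_one_lt_zCount hU hC3 hHclosed hHnormal, ?_⟩
  rintro ⟨H₁, H₂, ⟨hle₁, hc₁, hn₁, hz₁⟩, ⟨hle₂, hc₂, hn₂, hz₂⟩, hz⟩
  exact ArithCurve.one_lt_zCount_of_inf hU hHclosed hHnormal hle₁ hc₁ hn₁ hz₁ hle₂ hc₂ hn₂ hz₂ hz
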